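/- Let $1\le s<n$ be integers, and let $\mu,m,\varepsilon>0$. For $S\subseteq\{1,\dots,n\}$ let $x^S\in\mathbb R^n$ be the signal with $x^S_i=\mu$ for $i\in S$ and $x^S_i=0$ for $i\notin S$. An adaptive sensing procedure chooses, for $j=1,2,\dots$, a coordinate $A_j\in\{1,\dots,n\}$ and a precision $\Gamma_j\ge 0$ on the basis of the past $\{(A_i,\Gamma_i,Y_i)\}_{i<j}$ (and possibly extra randomization), by a rule that does not depend on the unknown $S$, and then observes $$Y_j=x^S_{A_j}+\Gamma_j^{-1/2}W_j,$$ where the $W_j$ are standard normal and $W_j$ is independent of the past and of $(A_j,\Gamma_j)$; $\Gamma_j=0$ means that no measurement is made at step $j$ (and $Y_j:=0$). Let $\mathbb E_S$ denote expectation under the resulting law of $\{(A_j,\Gamma_j,Y_j)\}_{j\ge1}$ when the support is $S$, and let $\hat S\subseteq\{1,\dots,n\}$ be an estimator that is a measurable function of $\{(A_j,\Gamma_j,Y_j)\}_{j\ge1}$. Let $\mathcal C'$ be the class of all subsets of $\{1,\dots,n\}$ of cardinality $s-1$ or $s$. Suppose that the procedure satisfies the precision budget $\mathbb E_S\big(\sum_j\Gamma_j\big)\le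 m$ for every $S\in\mathcal C'$ and that $$\max_{S\in\mathcal C'}\mathbb E_S|\hat S\,\triangle\,S|\le\varepsilon .$$ Then necessarily $$\mu\ \ge\ \sqrt{\frac{2(n-s)}{m}\left(\log s+\log\frac{n-s}{n+1}+\log\frac1{2\varepsilon}\right)},$$ where the right-hand side is read as $0$ if the expression under the root is negative. -/

import Mathlib

open MeasureTheory ProbabilityTheory
open scoped NNReal ENNReal

namespace AdaptiveSensing

/-- A sensing action `(A, Γ)`: the coordinate `A` to be measured and the precision `Γ` of the
measurement. Precision `Γ = 0` encodes that no measurement is made (see `observe`), so that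
procedures that stop after finitely many measurements are included. -/
abbrev Action (n : ℕ) : Type := Fin n × ℝ≥0

/-- One record `((A, Γ), Y)`: an action together with the resulting observation. -/
abbrev Record (n : ℕ) : Type := Action n × ℝ

/-- The signal `x` with support `S` and magnitude `μ`. -/
noncomputable def signal {n : ℕ} (μ : ℝ) (S : Finset (Fin n)) (i : Fin n) : ℝ :=
  if i ∈ S then μ else 0

/-- The observation `Y = x_A + Γ^{-1/2} W` obtained with action `(A, Γ)` and noise `W`;
if `Γ = 0`, nothing is observed and `Y` is set to `0`. -/
noncomputable def observe {n : ℕ} (μ : ℝ) (S : Finset (Fin n)) (a : Action n) (w : ℝ) : ℝ :=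
  if a.2 = 0 then 0 else signal μ S a.1 + (Real.sqrt (a.2 : ℝ))⁻¹ * w

theorem measurable_observe {n : ℕ} (μ : ℝ) (S : Finset (Fin n)) :
    Measurable (fun p : Action n × ℝ => observe μ S p.1 p.2) := by
  unfold observe
  refine Measurable.ite ?_ measurable_const ?_
  · exact (measurable_snd.comp measurable_fst) (measurableSet_singleton 0)
  · have h : Measurable (signal μ S) := measurable_of_finite _
    fun_prop

/-- The conditional law of the observation `Y` given the action: the law of `observe μ S a W`
with standard normal `W` (independent of the action and of the past). -/
noncomputable def obsKernel {n : ℕ} (μ : ℝ) (S : Finset (Fin n)) : Kernel (Action n) ℝ :=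
  (Kernel.id ×ₖ Kernel.const (Action n) (gaussianReal 0 1)).map
    (fun p : Action n × ℝ => observe μ S p.1 p.2)

instance {n : ℕ} (μ : ℝ) (S : Finset (Fin n)) : IsMarkovKernel (obsKernel μ S) :=
  Kernel.IsMarkovKernel.map _ (measurable_observe μ S)

/-- An adaptive sensing procedure for signals of length `n`, with its support estimator.
Each action may depend, possibly with additional randomization, on all past records; the rules do
not depend on the unknown support. The estimator is a function of the whole sequence of records. -/
structure Procedure (n : ℕ) where
  /-- the law of the first action -/
  first : Measure (Action n)
  /-- the conditional law of action `j + 1` given the records `0, …, j` -/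
  next : (j : ℕ) → Kernel (Finset.Iic j → Record n) (Action n)
  /-- the estimator of the support -/
  est : (ℕ → Record n) → Finset (Fin n)
  first_prob : IsProbabilityMeasure first
  next_markov : ∀ j, IsMarkovKernel (next j)
  est_meas : ∀ i, MeasurableSet {z | i ∈ est z}

attribute [instance] Procedure.first_prob Procedure.next_markov

/-- The joint law `P_S` of the infinite sequence of records when the signal has magnitude `μ` and
support `S`: actions are drawn by the procedure, observations by `obsKernel μ S`. -/
noncomputable def Procedure.law {n : ℕ} (π : Procedure n) (μ : ℝ) (S : Finset (Fin n)) :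
    Measure (ℕ → Record n) :=
  Kernel.trajMeasure (X := fun _ => Record n) (π.first ⊗ₘ obsKernel μ S)
    (fun j => π.next j ⊗ₖ Kernel.prodMkLeft _ (obsKernel μ S))

instance {n : ℕ} (π : Procedure n) (μ : ℝ) (S : Finset (Fin n)) :
    IsProbabilityMeasure (π.law μ S) := by
  unfold Procedure.law
  infer_instance

/-- The expected total precision `E_S (∑_j Γ_j)`. -/
noncomputable def Procedure.expectedPrecision {n : ℕ} (π : Procedure n) (μ : ℝ)
    (S : Finset (Fin n)) : ℝ≥0∞ :=
  ∫⁻ z, ∑' j, ((z j).1.2 : ℝ≥0∞) ∂(π.law μ S)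

/-- The expected Hamming distance `E_S |Ŝ ∆ S|`. -/
noncomputable def Procedure.risk {n : ℕ} (π : Procedure n) (μ : ℝ)
    (S : Finset (Fin n)) : ℝ≥0∞ :=
  ∫⁻ z, ((symmDiff (π.est z) S).card : ℝ≥0∞) ∂(π.law μ S)

/-- The class of all subsets of cardinality `s - 1` or `s`. -/
def nearSets (n s : ℕ) : Set (Finset (Fin n)) :=
  {S | S.card + 1 = s ∨ S.card = s}

end AdaptiveSensing

/-! Fix `S` with `s - 1` elements and `i ∉ S`. An estimator accurate on both `S` and `insert i S`
tests between these two supports through the event `i ∈ Ŝ`. The design rules cancel in the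
likelihood ratio, and only measurements of coordinate `i` contribute: the divergence of the law
under `insert i S` from that under `S` is `μ² / 2` times the expected precision spent on `i` under
`S` (`lintegral_law_insert`, `integral_logLik`). The Bretagnolle–Huber inequality then bounds the
sum of the two error probabilities below by `exp (-K) / 2` (`half_exp_neg_le_test`).

For fixed `S` the precisions over `i ∉ S` sum to at most `m`, so convexity of `exp` lets their
average, at most `m / (n - s + 1)`, replace each of them. Double counting the pairs `(S, i)` charges
false positives to sets of size `s - 1` and false negatives to sets of size `s`, each set with
Hamming risk at most `ε` (`half_mul_exp_neg_le_of_forall_insert`). Taking logarithms and weakening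
`n - s + 1` to `n - s` gives the bound. -/

namespace ProbabilityTheory

/-! ### Change of measure for trajectories -/

section trajMeasure

variable {X : ℕ → Type*} [∀ n, MeasurableSpace (X n)]
  {μ₀ ν₀ : Measure (X 0)}
  {κ η : (n : ℕ) → Kernel (Π i : Finset.Iic n, X i) (X (n + 1))}
  [∀ n, IsMarkovKernel (κ n)] [∀ n, IsMarkovKernel (η n)]

theorem map_zero_trajMeasure : (Kernel.trajMeasure μ₀ κ).map (fun z ↦ z 0) = μ₀ := by
  have h : (Kernel.trajMeasure μ₀ κ).map (Preorder.frestrictLe 0)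
      = μ₀.map (MeasurableEquiv.piUnique (fun i : Finset.Iic 0 ↦ X i)).symm := by
    rw [Kernel.trajMeasure, Measure.map_comp _ _ (by fun_prop), Kernel.traj_map_frestrictLe,
      Kernel.partialTraj_self]
    exact Measure.id_comp
  have h' := congrArg
    (Measure.map (MeasurableEquiv.piUnique (fun i : Finset.Iic 0 ↦ X i))) h
  rw [Measure.map_map (by fun_prop) (by fun_prop)] at h'
  exact h'.trans (MeasurableEquiv.map_map_symm (MeasurableEquiv.piUnique (fun i : Finset.Iic 0 ↦ X i)))

variable [IsProbabilityMeasure μ₀] [IsProbabilityMeasure ν₀]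

theorem lintegral_trajMeasure_succ {N : ℕ}
    {g : (Π i : Finset.Iic N, X i) × X (N + 1) → ℝ≥0∞} (hg : Measurable g) :
    ∫⁻ z, g (Preorder.frestrictLe N z, z (N + 1)) ∂(Kernel.trajMeasure μ₀ κ)
      = ∫⁻ z, ∫⁻ r, g (Preorder.frestrictLe N z, r) ∂(κ N (Preorder.frestrictLe N z))
          ∂(Kernel.trajMeasure μ₀ κ) := by
  rw [← lintegral_map hg (g := fun z ↦ (Preorder.frestrictLe N z, z (N + 1))) (by fun_prop),
    ← Kernel.map_frestrictLe_trajMeasure_compProd_eq_map_trajMeasure, Measure.lintegral_compProd hg,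
    lintegral_map (f := fun x ↦ ∫⁻ r, g (x, r) ∂(κ N x)) (Measurable.lintegral_kernel_prod_right' hg)
      (by fun_prop)]

/-- If the initial law and the transition kernels of one trajectory have densities with respect to
those of another which depend only on the new point, then on functions of the first coordinates
the law of the trajectory has the product of these densities as density. -/
theorem lintegral_trajMeasure_of_withDensity {L : (n : ℕ) → X n → ℝ≥0∞}
    (hL : ∀ n, Measurable (L n)) (h₀ : ν₀ = μ₀.withDensity (L 0))
    (hη : ∀ n x, η n x = (κ n x).withDensity (L (n + 1))) (N : ℕ)
    {f : (Π i : Finset.Iic N, X i) → ℝ≥0∞} (hf : Measurable f) :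
    ∫⁻ z, f (Preorder.frestrictLe N z) ∂(Kernel.trajMeasure ν₀ η)
      = ∫⁻ z, f (Preorder.frestrictLe N z) * ∏ j ∈ Finset.range (N + 1), L j (z j)
          ∂(Kernel.trajMeasure μ₀ κ) := by
  induction N with
  | zero =>
    let e : X 0 → Π i : Finset.Iic 0, X i :=
      (MeasurableEquiv.piUnique (fun i : Finset.Iic 0 ↦ X i)).symm
    have he : Measurable e := MeasurableEquiv.measurable _
    have e_eq (z : Π n, X n) : e (z 0) = Preorder.frestrictLe 0 z :=
      (MeasurableEquiv.piUnique (fun i : Finset.Iic 0 ↦ X i)).symm_apply_apply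
        (Preorder.frestrictLe 0 z)
    have hfe : Measurable fun x ↦ f (e x) := hf.comp he
    simp only [zero_add, Finset.range_one, Finset.prod_singleton, ← e_eq]
    rw [← lintegral_map (g := fun z : Π n, X n ↦ z 0) hfe (by fun_prop),
      ← lintegral_map (f := fun x ↦ f (e x) * L 0 x) (g := fun z : Π n, X n ↦ z 0)
        (hfe.mul (hL 0)) (by fun_prop), map_zero_trajMeasure, map_zero_trajMeasure, h₀,
      lintegral_withDensity_eq_lintegral_mul _ (hL 0) hfe]
    exact lintegral_congr fun x ↦ mul_comm _ _
  | succ N ih =>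
    -- Appends one coordinate to a history; the cast is needed because the last index equals `N + 1`
    -- only propositionally.
    set glue : (Π i : Finset.Iic N, X i) × X (N + 1) → Π i : Finset.Iic (N + 1), X i :=
      fun p i ↦ if h : i.1 ≤ N then p.1 ⟨i.1, Finset.mem_Iic.2 h⟩
        else cast (congrArg X (show N + 1 = i.1 by have := Finset.mem_Iic.1 i.2; omega)) p.2 with hglue
    have glue_meas : Measurable glue := by
      refine measurable_pi_iff.2 fun i ↦ ?_
      by_cases h : i.1 ≤ N
      · simp only [hglue, h, dite_true]
        fun_prop
      · obtain ⟨i, hi⟩ := i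
        obtain rfl : i = N + 1 := by have := Finset.mem_Iic.1 hi; simp only at h; omega
        simp only [hglue, h, dite_false]
        exact measurable_snd
    have glue_eq (z : Π n, X n) :
        glue (Preorder.frestrictLe N z, z (N + 1)) = Preorder.frestrictLe (N + 1) z := by
      funext i
      obtain ⟨i, hi⟩ := i
      by_cases h : i ≤ N
      · simp [hglue, h]
      · obtain rfl : i = N + 1 := by have := Finset.mem_Iic.1 hi; omega
        simp [hglue]
    have hD : Measurable fun x : (Π i : Finset.Iic N, X i) ↦ ∏ i, L i.1 (x i) :=
      Finset.measurable_prod _ fun i _ ↦ (hL i.1).comp (measurable_pi_apply i)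
    have hD_eq (z : Π n, X n) : (∏ i, L i.1 (Preorder.frestrictLe N z i))
        = ∏ j ∈ Finset.range (N + 1), L j (z j) := by
      rw [Nat.range_succ_eq_Iic]
      exact Finset.prod_coe_sort (Finset.Iic N) fun j ↦ L j (z j)
    have hg := hf.comp glue_meas
    simp only [← glue_eq]
    have e1 := lintegral_trajMeasure_succ (μ₀ := ν₀) (κ := η) hg
    have e2 := lintegral_trajMeasure_succ (μ₀ := μ₀) (κ := κ)
      (g := fun p ↦ f (glue p) * ((∏ i, L i.1 (p.1 i)) * L (N + 1) p.2))
      (hg.mul ((hD.comp measurable_fst).mul ((hL _).comp measurable_snd)))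
    simp only [hD_eq, Function.comp_apply] at e1 e2
    simp only [Finset.prod_range_succ _ (N + 1)]
    -- The induction hypothesis is applied to `f` with its last coordinate integrated out.
    rw [e1, e2, ih (f := fun x ↦ ∫⁻ r, f (glue (x, r)) ∂(η N x))
      (Measurable.lintegral_kernel_prod_right' hg)]
    refine lintegral_congr fun z ↦ ?_
    have hgz : Measurable fun r ↦ f (glue (Preorder.frestrictLe N z, r)) :=
      hg.comp measurable_prodMk_left
    rw [hη, lintegral_withDensity_eq_lintegral_mul _ (hL _) hgz,
      ← lintegral_mul_const _ ((hL _).mul hgz)]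
    refine lintegral_congr fun r ↦ ?_
    simp only [Pi.mul_apply]
    ring

end trajMeasure

end ProbabilityTheory

/-! ### Testing inequality and approximation by cylinders -/

namespace MeasureTheory

open Real in
/-- The Bretagnolle–Huber inequality, for a law with density `exp ∘ g` and a test event. -/
theorem half_exp_neg_le_of_exp_density {Ω : Type*} [MeasurableSpace Ω] {P Q : Measure Ω}
    [IsProbabilityMeasure P] [IsProbabilityMeasure Q] {g : Ω → ℝ} (hg : Measurable g)
    (hgi : Integrable g P) {K : ℝ} (hK : -K ≤ ∫ z, g z ∂P) {B : Set Ω} (hB : MeasurableSet B)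
    (hQB : Q B = ∫⁻ z in B, ENNReal.ofReal (exp (g z)) ∂P)
    (hQ : ∫⁻ z, ENNReal.ofReal (exp (g z)) ∂P = 1) :
    exp (-K) / 2 ≤ P.real B + Q.real Bᶜ := by
  have hexp : Integrable (fun z ↦ exp (g z)) P := by
    refine ⟨by fun_prop, ?_⟩
    rw [hasFiniteIntegral_iff_ofReal (ae_of_all _ fun z ↦ (exp_pos _).le), hQ]
    simp
  have hint : ∫ z, exp (g z) ∂P = 1 := by
    rw [integral_eq_lintegral_of_nonneg_ae (ae_of_all _ fun z ↦ (exp_pos _).le) (by fun_prop), hQ]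
    simp
  have hintB : ∫ z in B, exp (g z) ∂P = Q.real B := by
    rw [integral_eq_lintegral_of_nonneg_ae (ae_of_all _ fun z ↦ (exp_pos _).le) (by fun_prop),
      ← hQB]
    rfl
  have hintBc : ∫ z in Bᶜ, exp (g z) ∂P = Q.real Bᶜ := by
    have := integral_add_compl hB hexp
    rw [probReal_compl_eq_one_sub hB]
    linarith
  set c := exp (-K / 2) with hc
  have hc0 : 0 < c := exp_pos _
  have hcc : c * c = exp (-K) := by rw [hc, ← exp_add]; ring_nf
  -- Both steps of the usual proof at once, with `c = exp (-K / 2)`: the tangent line of `exp`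
  -- bounds `exp (g / 2)` below (Jensen), and AM-GM with weight `c`, used separately on `B` and
  -- `Bᶜ`, bounds it above (Cauchy–Schwarz).
  have pt (z : Ω) : c * (1 + g z / 2 + K / 2)
      ≤ (B.indicator (fun _ ↦ 1) z + Bᶜ.indicator (fun z ↦ exp (g z)) z) / c
        + c * (1 + exp (g z)) / 4 := by
    set e := exp (g z / 2) with he
    have hee : exp (g z) = e * e := by rw [he, ← exp_add]; ring_nf
    have h1 : c * (1 + g z / 2 + K / 2) ≤ e := by
      have : e = c * exp (g z / 2 + K / 2) := by rw [he, hc, ← exp_add]; ring_nf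
      rw [this]
      gcongr
      linarith [add_one_le_exp (g z / 2 + K / 2)]
    refine h1.trans ?_
    have e0 : 0 < e := exp_pos _
    by_cases hz : z ∈ B
    · simp only [Set.indicator_of_mem hz, Set.indicator_of_notMem (Set.notMem_compl_iff.2 hz), hee]
      have : (1 + 0) / c + c * (1 + e * e) / 4 - e = (1 - c * e / 2) ^ 2 / c + c / 4 := by
        field_simp; ring
      have : 0 ≤ (1 - c * e / 2) ^ 2 / c + c / 4 := by positivity
      linarith
    · simp only [Set.indicator_of_notMem hz, Set.indicator_of_mem (Set.mem_compl hz), hee]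
      have : (0 + e * e) / c + c * (1 + e * e) / 4 - e = (e - c / 2) ^ 2 / c + c * (e * e) / 4 := by
        field_simp; ring
      have : 0 ≤ (e - c / 2) ^ 2 / c + c * (e * e) / 4 := by positivity
      linarith
  have hi1 : Integrable (B.indicator (fun _ ↦ (1 : ℝ))) P :=
    (integrable_const _).indicator hB
  have hi2 : Integrable (Bᶜ.indicator (fun z ↦ exp (g z))) P := hexp.indicator hB.compl
  have hi3 : Integrable (fun z ↦ (B.indicator (fun _ ↦ 1) z + Bᶜ.indicator (fun z ↦ exp (g z)) z)
      / c) P := (hi1.add hi2).div_const c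
  have hi4 : Integrable (fun z ↦ c * (1 + exp (g z)) / 4) P :=
    (((integrable_const 1).add hexp).const_mul c).div_const 4
  have hmono := integral_mono (μ := P) (f := fun z ↦ c * (1 + g z / 2 + K / 2)) (by fun_prop)
    (hi3.add hi4) pt
  have l : ∫ z, c * (1 + g z / 2 + K / 2) ∂P = c * (1 + (∫ z, g z ∂P) / 2 + K / 2) := by
    rw [integral_const_mul, integral_add (by fun_prop) (by fun_prop),
      integral_add (by fun_prop) (by fun_prop), integral_div]
    simp
  have r : ∫ z, ((B.indicator (fun _ ↦ 1) z + Bᶜ.indicator (fun z ↦ exp (g z)) z) / c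
        + c * (1 + exp (g z)) / 4) ∂P = (P.real B + Q.real Bᶜ) / c + c * (1 + 1) / 4 := by
    rw [integral_add hi3 hi4, integral_div, integral_div,
      integral_const_mul, integral_add hi1 hi2, integral_add (by fun_prop) hexp,
      integral_indicator hB, integral_indicator hB.compl, hintBc, hint]
    simp
  have hm : c * (1 + (∫ z, g z ∂P) / 2 + K / 2)
      ≤ (P.real B + Q.real Bᶜ) / c + c * (1 + 1) / 4 := by
    rw [← l, ← r]; exact hmono
  have h2 : c ≤ (P.real B + Q.real Bᶜ) / c + c / 2 := by nlinarith
  have h3 : c / 2 * c ≤ P.real B + Q.real Bᶜ := by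
    rw [← le_div_iff₀ hc0]; linarith
  linarith

/-- An inequality between linear functionals of the measures of `B` and `Bᶜ` that holds for
cylinders holds for all measurable sets. -/
theorem le_real_add_real_compl_of_cylinder {X : ℕ → Type*} [∀ n, MeasurableSpace (X n)]
    {P Q : Measure (Π n, X n)} [IsProbabilityMeasure P] [IsProbabilityMeasure Q] {c : ℝ}
    (h : ∀ N, ∀ T : Set (Π i : Finset.Iic N, X i), MeasurableSet T →
      c ≤ P.real (cylinder (Finset.Iic N) T) + Q.real (cylinder (Finset.Iic N) T)ᶜ)
    {B : Set (Π n, X n)} (hB : MeasurableSet B) : c ≤ P.real B + Q.real Bᶜ := by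
  refine le_of_forall_pos_le_add fun δ hδ ↦ ?_
  -- Approximating with respect to `P + Q` makes one cylinder close to `B` under both laws.
  obtain ⟨C, hC, hlt⟩ := exists_measure_symmDiff_lt_of_generateFrom_isSetRing (μ := P + Q)
    isSetRing_measurableCylinders
    ⟨{Set.univ}, Set.countable_singleton _, 
      Set.singleton_subset_iff.2 (univ_mem_measurableCylinders X), by simp⟩
    generateFrom_measurableCylinders.symm hB (ENNReal.ofReal_pos.2 hδ)
  rw [measurableCylinders_nat] at hC
  simp only [Set.mem_iUnion, Set.mem_singleton_iff, exists_prop] at hC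
  obtain ⟨N, T, hT, rfl⟩ := hC
  set C := cylinder (Finset.Iic N) T
  have hCm : MeasurableSet C := hT.cylinder _
  have hsum : P.real (symmDiff C B) + Q.real (symmDiff C B) ≤ δ := by
    rw [← measureReal_add_apply]
    exact ENNReal.toReal_le_of_le_ofReal hδ.le hlt.le
  have hP : P.real C ≤ P.real B + P.real (symmDiff C B) := by
    refine (measureReal_mono ?_).trans (measureReal_union_le _ _)
    intro z hz
    by_cases hzB : z ∈ B
    · exact Or.inl hzB
    · exact Or.inr (Or.inl ⟨hz, hzB⟩)
  have hQ : Q.real Cᶜ ≤ Q.real Bᶜ + Q.real (symmDiff C B) := by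
    refine (measureReal_mono ?_).trans (measureReal_union_le _ _)
    intro z hz
    by_cases hzB : z ∈ B
    · exact Or.inr (Or.inr ⟨hzB, hz⟩)
    · exact Or.inl hzB
  linarith [h N T hT]

end MeasureTheory

/-! ### Likelihood ratio between neighbouring supports -/

namespace ProbabilityTheory

theorem gaussianReal_eq_withDensity_gaussianReal_zero (μ : ℝ) {v : ℝ≥0} (hv : v ≠ 0) :
    gaussianReal μ v = (gaussianReal 0 v).withDensity
      (fun y ↦ ENNReal.ofReal (Real.exp ((v : ℝ)⁻¹ * (μ * y - μ ^ 2 / 2)))) := by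
  rw [gaussianReal_of_var_ne_zero _ hv, gaussianReal_of_var_ne_zero _ hv,
    ← withDensity_mul _ (measurable_gaussianPDF _ _) (by fun_prop)]
  congr 1
  funext y
  rw [Pi.mul_apply, gaussianPDF, gaussianPDF, ← ENNReal.ofReal_mul (gaussianPDFReal_nonneg _ _ _),
    gaussianPDFReal, gaussianPDFReal, mul_assoc _ (Real.exp _), ← Real.exp_add]
  have : (v : ℝ) ≠ 0 := by exact_mod_cast hv
  congr 4
  field_simp
  ring

end ProbabilityTheory

namespace AdaptiveSensing

variable {n : ℕ} {μ : ℝ} {S : Finset (Fin n)} {i : Fin n}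

theorem obsKernel_apply (μ : ℝ) (S : Finset (Fin n)) (a : Action n) :
    obsKernel μ S a = (gaussianReal 0 1).map (observe μ S a) := by
  have h : Measurable (observe μ S a) := (measurable_observe μ S).comp measurable_prodMk_left
  rw [obsKernel, Kernel.map_apply _ (measurable_observe μ S), Kernel.prod_apply, Kernel.id_apply,
    Kernel.const_apply, Measure.dirac_prod,
    Measure.map_map (measurable_observe μ S) measurable_prodMk_left]
  rfl

/-- The log-likelihood ratio of one record between the supports `insert i S` and `S`. -/
noncomputable def logLik (μ : ℝ) (i : Fin n) (r : Record n) : ℝ :=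
  if r.1.1 = i then (r.1.2 : ℝ) * (μ * r.2 - μ ^ 2 / 2) else 0

theorem measurableSet_coordinate_eq (i : Fin n) : MeasurableSet {a : Action n | a.1 = i} :=
  measurable_fst (measurableSet_singleton i)

theorem measurable_logLik (μ : ℝ) (i : Fin n) : Measurable (logLik (n := n) μ i) :=
  Measurable.ite (measurable_fst (measurableSet_coordinate_eq i)) (by fun_prop) measurable_const

/-- The two laws differ only when `i` is measured with positive precision `Γ`; they are then
Gaussians of variance `1 / Γ` with means `μ` and `0`. Otherwise the log-likelihood ratio vanishes.
-/
theorem obsKernel_insert (hi : i ∉ S) (a : Action n) :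
    obsKernel μ (insert i S) a = (obsKernel μ S a).withDensity
      (fun y ↦ ENNReal.ofReal (Real.exp (logLik μ i (a, y)))) := by
  by_cases ha : a.1 = i
  · by_cases h0 : a.2 = 0
    · have h1 : observe μ (insert i S) a = observe μ S a := by
        funext w; simp [observe, h0]
      simp [obsKernel_apply, h1, logLik, h0]
    · have hΓ : (0 : ℝ) < a.2 := by exact_mod_cast pos_iff_ne_zero.2 h0
      have hv : (NNReal.mk ((Real.sqrt (a.2 : ℝ))⁻¹ ^ 2) (sq_nonneg _)) = (a.2)⁻¹ := by
        ext
        simp [inv_pow, Real.sq_sqrt hΓ.le]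
      have h1 : observe μ (insert i S) a
          = (fun x ↦ μ + x) ∘ (fun w ↦ (Real.sqrt (a.2 : ℝ))⁻¹ * w) := by
        funext w; simp [observe, h0, signal, ha]
      have h2 : observe μ S a = (fun w ↦ (Real.sqrt (a.2 : ℝ))⁻¹ * w) := by
        funext w; simp [observe, h0, signal, ha, hi]
      rw [obsKernel_apply, obsKernel_apply, h1, h2,
        ← Measure.map_map (by fun_prop) (by fun_prop), gaussianReal_map_const_mul,
        gaussianReal_map_const_add, hv]
      simp only [mul_zero, zero_add, mul_one]
      rw [gaussianReal_eq_withDensity_gaussianReal_zero μ (inv_ne_zero h0)]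
      simp [logLik, ha]
  · have h1 : observe μ (insert i S) a = observe μ S a := by
      funext w; simp [observe, signal, ha]
    simp [obsKernel_apply, h1, logLik, ha]

/-- The precision spent on coordinate `i` by one action. -/
noncomputable def precisionAt (i : Fin n) (a : Action n) : ℝ≥0 :=
  if a.1 = i then a.2 else 0

theorem measurable_precisionAt (i : Fin n) :
    Measurable (precisionAt (n := n) i) :=
  Measurable.ite (measurableSet_coordinate_eq i) measurable_snd measurable_const

namespace Procedure

variable (π : Procedure n)

/-- The rules choosing the actions are the same under both supports, so only the observation
densities remain in the ratio. -/
theorem lintegral_law_insert (hi : i ∉ S) (N : ℕ)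
    {f : (Finset.Iic N → Record n) → ℝ≥0∞} (hf : Measurable f) :
    ∫⁻ z, f (Preorder.frestrictLe N z) ∂(π.law μ (insert i S))
      = ∫⁻ z, f (Preorder.frestrictLe N z) *
          ENNReal.ofReal (Real.exp (∑ j ∈ Finset.range (N + 1), logLik μ i (z j)))
          ∂(π.law μ S) := by
  have hL : Measurable fun r : Record n ↦ ENNReal.ofReal (Real.exp (logLik μ i r)) :=
    (Real.measurable_exp.comp (measurable_logLik μ i)).ennreal_ofReal
  have h0 : π.first ⊗ₘ obsKernel μ (insert i S) = (π.first ⊗ₘ obsKernel μ S).withDensity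
      (fun r ↦ ENNReal.ofReal (Real.exp (logLik μ i r))) := by
    refine Measure.ext_of_lintegral _ fun g hg ↦ ?_
    rw [Measure.lintegral_compProd hg, lintegral_withDensity_eq_lintegral_mul _ hL hg,
      Measure.lintegral_compProd (hL.mul hg)]
    refine lintegral_congr fun a ↦ ?_
    rw [obsKernel_insert hi]
    exact lintegral_withDensity_eq_lintegral_mul _
      (hL.comp measurable_prodMk_left) (hg.comp measurable_prodMk_left)
  have h1 (j : ℕ) (x : Finset.Iic j → Record n) :
      (π.next j ⊗ₖ Kernel.prodMkLeft _ (obsKernel μ (insert i S))) x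
        = ((π.next j ⊗ₖ Kernel.prodMkLeft _ (obsKernel μ S)) x).withDensity
          (fun r ↦ ENNReal.ofReal (Real.exp (logLik μ i r))) := by
    refine Measure.ext_of_lintegral _ fun g hg ↦ ?_
    rw [Kernel.lintegral_compProd _ _ _ hg, lintegral_withDensity_eq_lintegral_mul _ hL hg,
      Kernel.lintegral_compProd _ _ _ (hL.mul hg)]
    refine lintegral_congr fun a ↦ ?_
    rw [Kernel.prodMkLeft_apply, Kernel.prodMkLeft_apply, obsKernel_insert hi]
    exact lintegral_withDensity_eq_lintegral_mul _
      (hL.comp measurable_prodMk_left) (hg.comp measurable_prodMk_left)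
  have := lintegral_trajMeasure_of_withDensity (X := fun _ ↦ Record n)
    (L := fun _ r ↦ ENNReal.ofReal (Real.exp (logLik μ i r))) (fun _ ↦ hL) h0 h1 N hf
  simp only [law]
  rw [this]
  refine lintegral_congr fun z ↦ ?_
  rw [Real.exp_sum, ENNReal.ofReal_prod_of_nonneg fun _ _ ↦ (Real.exp_pos _).le]

theorem exists_map_law_eq_compProd (μ : ℝ) (S : Finset (Fin n)) (j : ℕ) :
    ∃ ν : Measure (Action n), IsProbabilityMeasure ν ∧
      (π.law μ S).map (fun z ↦ z j) = ν ⊗ₘ obsKernel μ S := by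
  cases j with
  | zero => exact ⟨π.first, inferInstance, map_zero_trajMeasure (X := fun _ ↦ Record n)⟩
  | succ j =>
    have hp : IsProbabilityMeasure ((π.law μ S).map (Preorder.frestrictLe j)) :=
      Measure.isProbabilityMeasure_map (by fun_prop)
    refine ⟨π.next j ∘ₘ (π.law μ S).map (Preorder.frestrictLe j), inferInstance, ?_⟩
    refine Measure.ext_of_lintegral _ fun g hg ↦ ?_
    rw [lintegral_map hg (by fun_prop), Measure.lintegral_compProd hg,
      Measure.lintegral_bind (by fun_prop)
        (Measurable.lintegral_kernel_prod_right' hg).aemeasurable,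
      lintegral_map (Measurable.lintegral_kernel
        (Measurable.lintegral_kernel_prod_right' hg)) (by fun_prop)]
    have := lintegral_trajMeasure_succ (X := fun _ ↦ Record n) (N := j)
      (μ₀ := π.first ⊗ₘ obsKernel μ S)
      (κ := fun j ↦ π.next j ⊗ₖ Kernel.prodMkLeft _ (obsKernel μ S))
      (g := fun p ↦ g p.2) (hg.comp measurable_snd)
    refine this.trans (lintegral_congr fun z ↦ ?_)
    simp only [Kernel.lintegral_compProd _ _ _ hg, Kernel.prodMkLeft_apply]

/-- The record at time `j` has the law of an action together with its observation under
independent standard normal noise. -/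
theorem map_law_eq_map_prod (μ : ℝ) (S : Finset (Fin n)) (j : ℕ) :
    (π.law μ S).map (fun z ↦ z j)
      = (((π.law μ S).map (fun z ↦ (z j).1)).prod (gaussianReal 0 1)).map
          (fun p ↦ (p.1, observe μ S p.1 p.2)) := by
  obtain ⟨ν, hν, h⟩ := π.exists_map_law_eq_compProd μ S j
  have h1 : (π.law μ S).map (fun z ↦ (z j).1) = ν := by
    have := congrArg Measure.fst h
    rw [Measure.fst_compProd, Measure.fst, Measure.map_map measurable_fst (by fun_prop)] at this
    exact this
  rw [h1, h]
  have hm : Measurable fun p : Action n × ℝ ↦ (p.1, observe μ S p.1 p.2) :=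
    measurable_fst.prodMk (measurable_observe μ S)
  refine Measure.ext_of_lintegral _ fun g hg ↦ ?_
  rw [Measure.lintegral_compProd hg, lintegral_map hg hm]
  refine Eq.trans ?_ (lintegral_prod _ (hg.comp hm).aemeasurable).symm
  refine lintegral_congr fun a ↦ ?_
  rw [obsKernel_apply]
  exact lintegral_map (hg.comp measurable_prodMk_left)
    ((measurable_observe μ S).comp measurable_prodMk_left)

/-- Under `S` the coordinate `i` shows pure noise, so the log-likelihood ratio is `μ √Γ W - μ² Γ /
2`, with `Γ` the precision spent on `i`; as `W` is centred and independent of the action, only the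
drift survives. -/
theorem integral_logLik (hi : i ∉ S) (j : ℕ)
    (hΓ : Integrable (fun z ↦ (precisionAt i (z j).1 : ℝ)) (π.law μ S)) :
    Integrable (fun z ↦ logLik μ i (z j)) (π.law μ S) ∧
      ∫ z, logLik μ i (z j) ∂(π.law μ S)
        = -(μ ^ 2 / 2) * ∫ z, (precisionAt i (z j).1 : ℝ) ∂(π.law μ S) := by
  have hj : Measurable fun z : ℕ → Record n ↦ z j := measurable_pi_apply j
  have hj1 : Measurable fun z : ℕ → Record n ↦ (z j).1 := measurable_fst.comp hj
  have hmp := measurable_precisionAt (n := n) i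
  set ν := (π.law μ S).map (fun z ↦ (z j).1) with hν
  have hνp : IsProbabilityMeasure ν := Measure.isProbabilityMeasure_map hj1.aemeasurable
  have hΓν : Integrable (fun a ↦ (precisionAt i a : ℝ)) ν := by
    rw [hν, integrable_map_measure (by fun_prop) hj1.aemeasurable]
    exact hΓ
  -- The noise term carries the factor `√Γ`, which is integrable since `√Γ ≤ 1 + Γ`.
  have hsqrt : Integrable (fun a ↦ Real.sqrt (precisionAt i a)) ν := by
    refine ((integrable_const 1).add hΓν).mono' (by fun_prop) (ae_of_all _ fun a ↦ ?_)
    rw [Real.norm_of_nonneg (Real.sqrt_nonneg _), Pi.add_apply]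
    refine Real.sqrt_le_iff.2 ⟨by positivity, ?_⟩
    nlinarith [(precisionAt i a).coe_nonneg]
  have hid : Integrable (fun w : ℝ ↦ w) (gaussianReal 0 1) :=
    (memLp_id_gaussianReal 1).integrable le_rfl
  have hm : Measurable fun p : Action n × ℝ ↦ (p.1, observe μ S p.1 p.2) :=
    measurable_fst.prodMk (measurable_observe μ S)
  have hform (p : Action n × ℝ) : logLik μ i (p.1, observe μ S p.1 p.2)
      = μ * (Real.sqrt (precisionAt i p.1) * p.2) + -(μ ^ 2 / 2) * precisionAt i p.1 := by
    obtain ⟨a, w⟩ := p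
    by_cases ha : a.1 = i
    · by_cases h0 : a.2 = 0
      · simp [logLik, precisionAt, h0]
      · have hpos : (0 : ℝ) < a.2 := by exact_mod_cast pos_iff_ne_zero.2 h0
        have hs := Real.sq_sqrt hpos.le
        have hs0 := (Real.sqrt_pos.2 hpos).ne'
        simp only [logLik, precisionAt, observe, signal, h0, ha, hi, if_true, if_false, zero_add]
        nth_rw 1 [← hs]
        field_simp
        linear_combination (-μ ^ 2) * hs
    · simp [logLik, precisionAt, ha]
  have i1 : Integrable (fun p : Action n × ℝ ↦ μ * (Real.sqrt (precisionAt i p.1) * p.2))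
      (ν.prod (gaussianReal 0 1)) := (hsqrt.mul_prod hid).const_mul μ
  have i2 : Integrable (fun p : Action n × ℝ ↦ -(μ ^ 2 / 2) * (precisionAt i p.1 : ℝ))
      (ν.prod (gaussianReal 0 1)) := (hΓν.comp_fst _).const_mul _
  have hl := measurable_logLik (n := n) μ i
  constructor
  · have : Integrable (logLik μ i) ((π.law μ S).map (fun z ↦ z j)) := by
      rw [map_law_eq_map_prod, integrable_map_measure hl.aestronglyMeasurable hm.aemeasurable]
      exact (i1.add i2).congr (ae_of_all _ fun p ↦ (hform p).symm)
    rwa [integrable_map_measure hl.aestronglyMeasurable hj.aemeasurable] at this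
  · rw [← integral_map (φ := fun z : ℕ → Record n ↦ z j) hj.aemeasurable hl.aestronglyMeasurable,
      map_law_eq_map_prod, integral_map hm.aemeasurable hl.aestronglyMeasurable]
    simp only [hform]
    rw [integral_add i1 i2, integral_const_mul, integral_const_mul,
      integral_prod_mul (fun a ↦ Real.sqrt (precisionAt i a)) (fun w : ℝ ↦ w),
      integral_fun_fst (fun a ↦ (precisionAt i a : ℝ)),
      integral_map (φ := fun z : ℕ → Record n ↦ (z j).1) (f := fun a ↦ (precisionAt i a : ℝ))
        hj1.aemeasurable (by fun_prop)]
    simp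

end Procedure

end AdaptiveSensing

/-! ### Averaging over supports -/

/-- The map `(S, i) ↦ (insert i S, i)` is a bijection, with inverse given by erasing `i`. -/
theorem Finset.sum_powersetCard_sum_compl_insert {α M : Type*} [Fintype α] [DecidableEq α]
    [AddCommMonoid M] (k : ℕ) (f : Finset α → α → M) :
    ∑ S ∈ powersetCard k (univ : Finset α), ∑ i ∈ Sᶜ, f (insert i S) i
      = ∑ S ∈ powersetCard (k + 1) (univ : Finset α), ∑ i ∈ S, f S i := by
  rw [sum_sigma', sum_sigma']
  refine sum_bij' (fun p _ ↦ ⟨insert p.2 p.1, p.2⟩) (fun p _ ↦ ⟨p.1.erase p.2, p.2⟩) ?_ ?_ ?_ ?_ ?_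
  · rintro ⟨S, i⟩ h
    simp only [mem_sigma, mem_powersetCard_univ, mem_compl] at h ⊢
    exact ⟨by rw [card_insert_of_notMem h.2, h.1], mem_insert_self _ _⟩
  · rintro ⟨S, i⟩ h
    simp only [mem_sigma, mem_powersetCard_univ, mem_compl] at h ⊢
    exact ⟨by rw [card_erase_of_mem h.2, h.1, Nat.add_sub_cancel], notMem_erase _ _⟩
  · rintro ⟨S, i⟩ h
    simp only [mem_sigma, mem_compl] at h
    simp [erase_insert h.2]
  · rintro ⟨S, i⟩ h
    simp only [mem_sigma] at h
    simp [insert_erase h.2]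
  · simp

/-- Summing testing bounds `exp (-K S i) / 2 ≤ a S i + b (insert i S) i` over all sets `S` with `k`
elements and all `i ∉ S`. -/
theorem half_mul_exp_neg_le_of_forall_insert {n k : ℕ} (hk : k < n)
    {a b K : Finset (Fin n) → Fin n → ℝ} {A E : ℝ}
    (htest : ∀ S i, S.card = k → i ∉ S → Real.exp (-K S i) / 2 ≤ a S i + b (insert i S) i)
    (hK : ∀ S, S.card = k → ∑ i ∈ Sᶜ, K S i ≤ A)
    (ha : ∀ S, S.card = k → ∑ i ∈ Sᶜ, a S i ≤ E)
    (hb : ∀ S, S.card = k + 1 → ∑ i ∈ S, b S i ≤ E) :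
    ((n : ℝ) - k) * (k + 1) * Real.exp (-(A / (n - k))) / 2 ≤ E * (n + 1) := by
  have hd : (0 : ℝ) < n - k := sub_pos.2 (by exact_mod_cast hk)
  set C := (Finset.powersetCard k (Finset.univ : Finset (Fin n)))
  set C' := (Finset.powersetCard (k + 1) (Finset.univ : Finset (Fin n)))
  have hC {S} (hS : S ∈ C) : S.card = k := (Finset.mem_powersetCard_univ.1 hS)
  have hC' {S} (hS : S ∈ C') : S.card = k + 1 := (Finset.mem_powersetCard_univ.1 hS)
  have hcompl {S : Finset (Fin n)} (hS : S ∈ C) : (Sᶜ.card : ℝ) = n - k := by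
    rw [Finset.card_compl, hC hS, Fintype.card_fin, Nat.cast_sub hk.le]
  have hcard : (C.card : ℝ) * (n - k) = C'.card * (k + 1) := by
    have h := Finset.sum_powersetCard_sum_compl_insert (α := Fin n) (M := ℝ) k (fun _ _ ↦ 1)
    simp only [Finset.sum_const, nsmul_eq_mul, mul_one] at h
    rw [Finset.sum_congr rfl fun S hS ↦ hcompl hS,
      Finset.sum_congr (s₁ := Finset.powersetCard (k + 1) _) rfl
        fun S hS ↦ congrArg Nat.cast (hC' hS)] at h
    rw [Finset.sum_const, Finset.sum_const, nsmul_eq_mul, nsmul_eq_mul] at h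
    exact_mod_cast h
  have hCpos : (0 : ℝ) < C.card := by
    rw [Finset.card_powersetCard, Finset.card_univ, Fintype.card_fin]
    exact_mod_cast Nat.choose_pos hk.le
  set e := Real.exp (-(A / (n - k)))
  have he : 0 < e := Real.exp_pos _
  have hrow {S : Finset (Fin n)} (hS : S ∈ C) :
      (n - k) * e / 2 ≤ ∑ i ∈ Sᶜ, (a S i + b (insert i S) i) := by
    -- Jensen's inequality through the tangent line of `exp (-·)` at the mean bound `A / (n - k)`.
    have h1 : ∑ i ∈ Sᶜ, e * (1 - K S i + A / (n - k)) / 2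
        ≤ ∑ i ∈ Sᶜ, (a S i + b (insert i S) i) := by
      refine Finset.sum_le_sum fun i hi ↦ le_trans ?_ (htest S i (hC hS) (Finset.mem_compl.1 hi))
      have : Real.exp (-K S i) = e * Real.exp (-K S i + A / (n - k)) := by
        rw [← Real.exp_add]; ring_nf
      rw [this]
      gcongr
      linarith [Real.add_one_le_exp (-K S i + A / (n - k))]
    have h2 : ∑ i ∈ Sᶜ, e * (1 - K S i + A / (n - k)) / 2
        = e * ((n - k) - ∑ i ∈ Sᶜ, K S i + (n - k) * (A / (n - k))) / 2 := by
      rw [← Finset.sum_div, ← Finset.mul_sum, Finset.sum_add_distrib, Finset.sum_sub_distrib,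
        Finset.sum_const, Finset.sum_const, nsmul_eq_mul, nsmul_eq_mul, hcompl hS, mul_one]
    rw [mul_div_cancel₀ _ hd.ne'] at h2
    have h3 : 0 ≤ e * (A - ∑ i ∈ Sᶜ, K S i) :=
      mul_nonneg he.le (sub_nonneg.2 (hK S (hC hS)))
    linarith
  have htotal := Finset.sum_le_sum fun S hS ↦ hrow (S := S) hS
  simp only [Finset.sum_add_distrib] at htotal
  rw [Finset.sum_powersetCard_sum_compl_insert, Finset.sum_const, nsmul_eq_mul] at htotal
  have hA : ∑ S ∈ C, ∑ i ∈ Sᶜ, a S i ≤ C.card * E := by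
    rw [← nsmul_eq_mul]
    exact Finset.sum_le_card_nsmul _ _ _ fun S hS ↦ ha S (hC hS)
  have hB : ∑ S ∈ C', ∑ i ∈ S, b S i ≤ C'.card * E := by
    rw [← nsmul_eq_mul]
    exact Finset.sum_le_card_nsmul _ _ _ fun S hS ↦ hb S (hC' hS)
  have hsum : C.card * ((n - k) * e / 2) ≤ C.card * E + C'.card * E := by linarith
  have hk1 : (0 : ℝ) < k + 1 := by positivity
  refine le_of_mul_le_mul_left ?_ hCpos
  have := mul_le_mul_of_nonneg_right hsum hk1.le
  -- By `hcard`, the two error budgets carry weights `k + 1` and `n - k`; their sum is the `n + 1`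
  -- of the bound.
  have e2 : (C.card * E + C'.card * E) * ((k : ℝ) + 1) = C.card * (E * (n + 1)) := by
    linear_combination (-E) * hcard
  linarith

/-! ### Testing and Hamming risk of a procedure -/

namespace AdaptiveSensing

variable {n : ℕ} {μ : ℝ} {S : Finset (Fin n)} {i : Fin n}

namespace Procedure

variable (π : Procedure n)

/-- The expected total precision spent on coordinate `i`. -/
noncomputable def expectedPrecisionAt (μ : ℝ) (S : Finset (Fin n)) (i : Fin n) : ℝ≥0∞ :=
  ∫⁻ z, ∑' j, (precisionAt i (z j).1 : ℝ≥0∞) ∂(π.law μ S)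

theorem measurable_precisionAt_apply (i : Fin n) (j : ℕ) :
    Measurable fun z : ℕ → Record n ↦ (precisionAt i (z j).1 : ℝ≥0∞) :=
  ((measurable_precisionAt i).comp (measurable_fst.comp (measurable_pi_apply j))).coe_nnreal_ennreal

theorem sum_expectedPrecisionAt (μ : ℝ) (S : Finset (Fin n)) :
    ∑ i, π.expectedPrecisionAt μ S i = π.expectedPrecision μ S := by
  simp only [expectedPrecisionAt, expectedPrecision]
  rw [← lintegral_finsetSum _ fun i _ ↦
    Measurable.tsum fun j ↦ measurable_precisionAt_apply i j]
  refine lintegral_congr fun z ↦ ?_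
  rw [← Summable.tsum_finsetSum fun _ _ ↦ ENNReal.summable]
  refine tsum_congr fun j ↦ ?_
  rw [← ENNReal.ofNNReal_finsetSum]
  simp [precisionAt]

/-- The likelihood ratio is available for finitely many records, where the divergence is at most `K`
because partial sums of precision are at most the total. The bound is uniform in the number of
records, so it passes to events of the whole sequence without a density for the full law. -/
theorem half_exp_neg_le_test (hi : i ∉ S) (hfin : π.expectedPrecisionAt μ S i ≠ ∞) :
    Real.exp (-(μ ^ 2 / 2 * (π.expectedPrecisionAt μ S i).toReal)) / 2
      ≤ (π.law μ S).real {z | i ∈ π.est z} + (π.law μ (insert i S)).real {z | i ∈ π.est z}ᶜ := by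
  refine le_real_add_real_compl_of_cylinder (fun N T hT ↦ ?_) (π.est_meas i)
  have htsum : π.expectedPrecisionAt μ S i
      = ∑' j, ∫⁻ z, (precisionAt i (z j).1 : ℝ≥0∞) ∂(π.law μ S) :=
    lintegral_tsum fun j ↦ (measurable_precisionAt_apply i j).aemeasurable
  have hj (j : ℕ) : ∫⁻ z, (precisionAt i (z j).1 : ℝ≥0∞) ∂(π.law μ S) ≠ ∞ :=
    ne_top_of_le_ne_top hfin (htsum ▸ ENNReal.le_tsum j)
  have hm (j : ℕ) : Measurable fun z : ℕ → Record n ↦ (precisionAt i (z j).1 : ℝ) :=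
    ((measurable_precisionAt i).comp
      (measurable_fst.comp (measurable_pi_apply j))).coe_nnreal_real
  have hΓ (j : ℕ) : Integrable (fun z ↦ (precisionAt i (z j).1 : ℝ)) (π.law μ S) := by
    refine ⟨(hm j).aestronglyMeasurable, ?_⟩
    rw [hasFiniteIntegral_iff_ofReal (ae_of_all _ fun z ↦ NNReal.coe_nonneg _)]
    simpa using (hj j).lt_top
  have hΓint (j : ℕ) : ∫ z, (precisionAt i (z j).1 : ℝ) ∂(π.law μ S)
      = (∫⁻ z, (precisionAt i (z j).1 : ℝ≥0∞) ∂(π.law μ S)).toReal := by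
    rw [integral_eq_lintegral_of_nonneg_ae (ae_of_all _ fun z ↦ NNReal.coe_nonneg _)
      (hm j).aestronglyMeasurable]
    simp
  have hlm (j : ℕ) : Measurable fun z : ℕ → Record n ↦ logLik μ i (z j) :=
    (measurable_logLik μ i).comp (measurable_pi_apply j)
  refine half_exp_neg_le_of_exp_density
    (g := fun z ↦ ∑ j ∈ Finset.range (N + 1), logLik μ i (z j))
    (Finset.measurable_sum _ fun j _ ↦ hlm j)
    (integrable_finsetSum _ fun j _ ↦ (π.integral_logLik hi j (hΓ j)).1) ?_ (hT.cylinder _) ?_ ?_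
  · rw [integral_finsetSum _ fun j _ ↦ (π.integral_logLik hi j (hΓ j)).1]
    simp only [fun j ↦ (π.integral_logLik (μ := μ) hi j (hΓ j)).2, hΓint]
    rw [← Finset.mul_sum, ← ENNReal.toReal_sum fun j _ ↦ hj j, neg_mul, neg_le_neg_iff]
    refine mul_le_mul_of_nonneg_left (ENNReal.toReal_mono hfin ?_) (by positivity)
    rw [htsum]
    exact ENNReal.sum_le_tsum _
  · have h := π.lintegral_law_insert (μ := μ) hi N (f := T.indicator 1)
      (measurable_one.indicator hT)
    have e (z : ℕ → Record n) : T.indicator (1 : (Finset.Iic N → Record n) → ℝ≥0∞) (Preorder.frestrictLe N z)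
        = (cylinder (Finset.Iic N) T).indicator 1 z := rfl
    simp only [e] at h
    rw [lintegral_indicator_one (hT.cylinder _)] at h
    rw [h, ← lintegral_indicator (hT.cylinder _)]
    refine lintegral_congr fun z ↦ ?_
    by_cases hz : z ∈ cylinder (Finset.Iic N) T <;> simp [hz]
  · have h := π.lintegral_law_insert (μ := μ) hi N (f := fun _ ↦ 1) measurable_const
    simpa using h.symm

/-- The sum of the probabilities is the expected number of `i ∈ T` whose event occurs, and each such
`i` is an error of the estimator. -/
theorem sum_real_le_of_risk_le {ε : ℝ} (hε : 0 ≤ ε) (h : π.risk μ S ≤ ENNReal.ofReal ε)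
    (T : Finset (Fin n)) {B : Fin n → Set (ℕ → Record n)} (hB : ∀ i, MeasurableSet (B i))
    (hBT : ∀ z, ∀ i ∈ T, z ∈ B i → i ∈ symmDiff (π.est z) S) :
    ∑ i ∈ T, (π.law μ S).real (B i) ≤ ε := by
  simp only [measureReal_def]
  rw [← ENNReal.toReal_sum fun i _ ↦ measure_ne_top _ _]
  refine ENNReal.toReal_le_of_le_ofReal hε (le_trans ?_ h)
  simp only [← lintegral_indicator_one (hB _)]
  rw [← lintegral_finsetSum _ fun i _ ↦ measurable_one.indicator (hB i)]
  refine lintegral_mono fun z ↦ ?_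
  classical
  have : ∑ i ∈ T, (B i).indicator (1 : (ℕ → Record n) → ℝ≥0∞) z = ((T.filter fun i ↦ z ∈ B i).card : ℝ≥0∞) := by
    rw [Finset.card_filter, Nat.cast_sum]
    refine Finset.sum_congr rfl fun i _ ↦ ?_
    by_cases hz : z ∈ B i <;> simp [hz]
  rw [this]
  exact Nat.cast_le.2 <| Finset.card_le_card fun i hi ↦
    hBT z i (Finset.mem_filter.1 hi).1 (Finset.mem_filter.1 hi).2

end Procedure

end AdaptiveSensing

/-! ### The lower bound -/

theorem proposition13 (n s : ℕ) (hs : 1 ≤ s) (hsn : s < n)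
    (μ m ε : ℝ) (hμ : 0 < μ) (hm : 0 < m) (hε : 0 < ε)
    (π : AdaptiveSensing.Procedure n)
    (hbudget : ∀ S ∈ AdaptiveSensing.nearSets n s, π.expectedPrecision μ S ≤ ENNReal.ofReal m)
    (hrisk : ∀ S ∈ AdaptiveSensing.nearSets n s, π.risk μ S ≤ ENNReal.ofReal ε) :
    Real.sqrt (2 * ((n : ℝ) - s) / m *
      (Real.log s + Real.log (((n : ℝ) - s) / (n + 1)) + Real.log (1 / (2 * ε)))) ≤ μ := by
  obtain ⟨k, rfl⟩ : ∃ k, s = k + 1 := ⟨s - 1, by omega⟩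
  have hfin {S : Finset (Fin n)} (hS : S.card = k) : ∑ i, π.expectedPrecisionAt μ S i ≠ ∞ := by
    rw [π.sum_expectedPrecisionAt]
    exact ne_top_of_le_ne_top ENNReal.ofReal_ne_top (hbudget S (Or.inl (by rw [hS])))
  have hfin' {S : Finset (Fin n)} (hS : S.card = k) (i : Fin n) :
      π.expectedPrecisionAt μ S i ≠ ∞ := (ENNReal.sum_ne_top.1 (hfin hS)) i (Finset.mem_univ i)
  have main := half_mul_exp_neg_le_of_forall_insert (n := n) (k := k) (by omega)
    (a := fun S i ↦ (π.law μ S).real {z | i ∈ π.est z})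
    (b := fun S i ↦ (π.law μ S).real {z | i ∈ π.est z}ᶜ)
    (K := fun S i ↦ μ ^ 2 / 2 * (π.expectedPrecisionAt μ S i).toReal)
    (A := μ ^ 2 / 2 * m) (E := ε)
    (fun S i hS hi ↦ π.half_exp_neg_le_test hi (hfin' hS i))
    (fun S hS ↦ by
      rw [← Finset.mul_sum, ← ENNReal.toReal_sum fun i _ ↦ hfin' hS i]
      refine mul_le_mul_of_nonneg_left (ENNReal.toReal_le_of_le_ofReal hm.le ?_) (by positivity)
      refine le_trans ?_ (hbudget S (Or.inl (by rw [hS])))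
      rw [← π.sum_expectedPrecisionAt]
      exact Finset.sum_le_sum_of_subset (Finset.subset_univ _))
    (fun S hS ↦ π.sum_real_le_of_risk_le hε.le (hrisk S (Or.inl (by rw [hS]))) Sᶜ π.est_meas
      fun z i hi hz ↦ Finset.mem_symmDiff.2 (Or.inl ⟨hz, Finset.mem_compl.1 hi⟩))
    (fun S hS ↦ π.sum_real_le_of_risk_le hε.le (hrisk S (Or.inr hS)) S
      (fun i ↦ (π.est_meas i).compl)
      fun z i hi hz ↦ Finset.mem_symmDiff.2 (Or.inr ⟨hi, hz⟩))
  rw [Real.sqrt_le_left hμ.le]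
  have hd : (0 : ℝ) < n - (k + 1 : ℕ) := sub_pos.2 (by exact_mod_cast hsn)
  push_cast at hd ⊢
  have hk1 : (0 : ℝ) < k + 1 := by positivity
  have hn1 : (0 : ℝ) < n + 1 := by positivity
  rw [← Real.log_mul hk1.ne' (div_pos hd hn1).ne', ← Real.log_mul (by positivity) (by positivity)]
  set x : ℝ := (k + 1) * ((n - (k + 1)) / (n + 1)) * (1 / (2 * ε)) with hx
  have hx0 : 0 < x := by positivity
  have hd' : (0 : ℝ) < n - k := by linarith
  have hexp : x ≤ Real.exp (μ ^ 2 / 2 * m / (n - k)) := by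
    -- With `k = s - 1` the argument yields `n - k = n - s + 1`; the statement has the smaller `n -
    -- s`.
    have h1 : x ≤ (k + 1) * ((n - k) / (n + 1)) * (1 / (2 * ε)) := by
      rw [hx]; gcongr; linarith
    refine h1.trans ?_
    rw [Real.exp_neg] at main
    set e := Real.exp (μ ^ 2 / 2 * m / (n - k))
    have he : 0 < e := Real.exp_pos _
    rw [show ((k : ℝ) + 1) * ((n - k) / (n + 1)) * (1 / (2 * ε))
      = ((n - k) * (k + 1) / 2) / (ε * (n + 1)) by field_simp, div_le_iff₀ (by positivity)]
    have := mul_le_mul_of_nonneg_right main he.le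
    have e3 : ((n : ℝ) - k) * (k + 1) * e⁻¹ / 2 * e = (n - k) * (k + 1) / 2 := by field_simp
    linarith
  have hlog : Real.log x ≤ μ ^ 2 / 2 * m / (n - k) := (Real.log_le_iff_le_exp hx0).2 hexp
  rw [le_div_iff₀ hd'] at hlog
  rw [div_mul_eq_mul_div, div_le_iff₀ hm]
  -- Replacing the factor `n - k` by `n - (k + 1)` needs `log x ≥ 0`; otherwise the left side is
  -- nonpositive.
  rcases le_total (Real.log x) 0 with hneg | hpos
  · have : (n - ((k : ℝ) + 1)) * Real.log x ≤ 0 := mul_nonpos_of_nonneg_of_nonpos hd.le hneg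
    nlinarith [mul_pos (pow_pos hμ 2) hm]
  · nlinarith
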